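/- Call a real Lie algebra $\mathfrak g$ of type $\mathfrak g_{3,2}$ if it is three-dimensional and has a basis $(E_1,E_2,E_3)$ (an adapted basis) with $$[E_1,E_2]=0,\qquad [E_3,E_1]=E_1,\qquad [E_2,E_3]=E_1-E_2 .$$ (1) Let $(E_1,E_2,E_3)$ be an adapted basis of a Lie algebra $\mathfrak g$ of type $\mathfrak g_{3,2}$. The derivations of $\mathfrak g$ are exactly the linear maps whose matrix in this basis (the $j$-th column holding the coordinates of $\mathcal D(E_j)$) is $$\begin{pmatrix}\alpha & x_2 & x_3\\ 0&\alpha&y_3\\ 0&0&0\end{pmatrix},\qquad \alpha,x_2,x_3,y_3\in\mathbb R .$$ The characteristic polynomial of such a derivation is $\lambda(\lambda-\alpha)^2$; in particular all its eigenvalues ($\alpha,\alpha,0$) are real. (2) Let $G$ be a simply connected (in particular connected) real Lie group whose Lie algebra is of type $\mathfrak g_{3,2}$. Let $\mathcal X$ be a linear vector field on $G$, that is, a smooth vector field whose flow $(\varphi_t)_{t\in\mathbb R}$ consists of automorphisms of the Lie group $G$. Then the linear flow $\varphi_t$ has no periodic orbits: there is no $g\in G$ that is not a fixed point of the flow and for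 which there is $T>0$ with $\varphi_{t+T}(g)=\varphi_t(g)$ for all $t\in\mathbb R$. -/

import Mathlib

open scoped Manifold ContDiff

/-- The ordered basis `E = (E 0, E 1, E 2) = (E₁, E₂, E₃)` realises the three-dimensional bracket
relations with parameters `a, n₁, n₂, n₃`:
`[E₁, E₂] = n₃ E₃`, `[E₃, E₁] = a E₁ + n₂ E₂`, `[E₂, E₃] = n₁ E₁ - a E₂`. -/
structure HasStructureConstants {L : Type*} [AddCommGroup L] [Module ℝ L] [Bracket L L]
    (a n₁ n₂ n₃ : ℝ) (E : Module.Basis (Fin 3) ℝ L) : Prop where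
  lie_one_two : ⁅E 0, E 1⁆ = n₃ • E 2
  lie_three_one : ⁅E 2, E 0⁆ = a • E 0 + n₂ • E 1
  lie_two_three : ⁅E 1, E 2⁆ = n₁ • E 0 - a • E 1

/-- `E` is a basis adapted to type `𝔤_{3,2}`: the parameters are `a = 1`, `n₁ = 1`, `n₂ = n₃ = 0`,
that is `[E₁, E₂] = 0`, `[E₃, E₁] = E₁`, `[E₂, E₃] = E₁ - E₂`. -/
def IsG32Basis {L : Type*} [AddCommGroup L] [Module ℝ L] [Bracket L L]
    (E : Module.Basis (Fin 3) ℝ L) : Prop :=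
  HasStructureConstants 1 1 0 0 E

/-- `L` is of type `𝔤_{3,2}`, i.e. it possesses a basis adapted to that type. -/
def IsOfTypeG32 (L : Type*) [AddCommGroup L] [Module ℝ L] [Bracket L L] : Prop :=
  ∃ E : Module.Basis (Fin 3) ℝ L, IsG32Basis E

section LinearFlows

variable {E : Type*} [NormedAddCommGroup E] [NormedSpace ℝ E]
  {H : Type*} [TopologicalSpace H] (I : ModelWithCorners ℝ E H)
  {G : Type*} [TopologicalSpace G] [ChartedSpace H G]

/-- `ψ` is an automorphism of the Lie group `G`: a group automorphism that is smooth together with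
its inverse. -/
def IsLieGroupAutomorphism [Group G] (ψ : G → G) : Prop :=
  ∃ e : G ≃* G, ⇑e = ψ ∧ ContMDiff I I ∞ e ∧ ContMDiff I I ∞ e.symm

/-- `φ` is the (globally defined) flow of the vector field `X`: for every `g`, the curve
`t ↦ φ t g` is the solution of `ġ = X(g)` that starts at `g`. -/
structure IsGlobalFlow (X : (g : G) → TangentSpace I g) (φ : ℝ → G → G) :
    Prop where
  initial : ∀ g, φ 0 g = g
  integralCurve : ∀ g, IsMIntegralCurve (I := I) (fun t => φ t g) X

/-- `X` is a linear vector field on the Lie group `G` and `φ` is its (linear) flow: `X` is smooth,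
`φ` is the flow of `X`, and every `φ t` is an automorphism of the Lie group `G`. -/
structure IsLinearVectorFieldWithFlow [Group G] [LieGroup I ∞ G]
    (X : (g : G) → TangentSpace I g) (φ : ℝ → G → G) : Prop where
  smooth : ContMDiff I I.tangent ∞ (fun g => (⟨g, X g⟩ : TangentBundle I G))
  flow : IsGlobalFlow I X φ
  automorphism : ∀ t, IsLieGroupAutomorphism I (φ t)

end LinearFlows

/-- The orbit of `g` under `φ` is periodic: it is not a fixed point, and it closes up after some
time `T > 0`. -/
def IsPeriodicOrbit {G : Type*} (φ : ℝ → G → G) (g : G) : Prop :=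
  (¬ ∀ t, φ t g = g) ∧ ∃ T : ℝ, 0 < T ∧ ∀ t, φ (t + T) g = φ t g

/-! Part (1) is linear algebra: applying a derivation to the two nonzero bracket relations and
comparing coordinates forces the matrix, and every such matrix satisfies the Leibniz rule.

Part (2) is proved through the adjoint representation. Write `B_t` for the differential of `φ t` at
`1`. Then `Ad (φ t g) = B_t (Ad g) B_t⁻¹`, so the times at which `B_t` commutes with `Ad g` form a
subgroup of `ℝ`. It is closed, because `t ↦ Ad (φ t g) v` is continuous for each `v`, and it
contains every `T` with `φ T g = g`. Automorphisms of the Lie algebra are upper triangular with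
diagonal `(a, a, 1)`, `a ≠ 0` (`toMatrix_automorphism`). Since `B_t` is the square of `B_{t/2}`, its
diagonal is positive, so `-1` is not an eigenvalue, and what commutes with `B_t ^ 2` commutes with
`B_t`. Hence the subgroup is stable under halving; as it contains some `T > 0`, it is dense, thus
all of `ℝ`, and `Ad` is constant along the orbit. The centre of the Lie algebra is trivial, so such
an orbit has zero velocity (`velocity_eq_zero_of_adjointMap_eq`), and `g` is a fixed point. -/

section Algebra

/-! ### Brackets, derivations and automorphisms in adapted coordinates. -/

section Bracket

variable {L : Type*} [LieRing L] [LieAlgebra ℝ L] {E : Module.Basis (Fin 3) ℝ L}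

/-- The bracket of a Lie algebra of type `𝔤_{3,2}` in the coordinates of an adapted basis. -/
lemma IsG32Basis.lie_eq (hE : IsG32Basis E) (u v : L) :
    ⁅u, v⁆ = (E.repr u 2 * (E.repr v 0 - E.repr v 1)
        - E.repr v 2 * (E.repr u 0 - E.repr u 1)) • E 0
      + (E.repr u 2 * E.repr v 1 - E.repr v 2 * E.repr u 1) • E 1 := by
  have h01 : ⁅E 0, E 1⁆ = 0 := by simpa using hE.lie_one_two
  have h20 : ⁅E 2, E 0⁆ = E 0 := by simpa using hE.lie_three_one
  have h12 : ⁅E 1, E 2⁆ = E 0 - E 1 := by simpa using hE.lie_two_three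
  have h10 : ⁅E 1, E 0⁆ = 0 := by rw [← lie_skew, h01, neg_zero]
  have h02 : ⁅E 0, E 2⁆ = -E 0 := by rw [← lie_skew, h20]
  have h21 : ⁅E 2, E 1⁆ = E 1 - E 0 := by rw [← lie_skew, h12, neg_sub]
  conv_lhs => rw [← E.sum_repr u, ← E.sum_repr v]
  simp only [Fin.sum_univ_three, lie_add, add_lie, lie_smul, smul_lie, lie_self, h01, h20, h12,
    h10, h02, h21]
  module

lemma IsG32Basis.repr_lie_zero (hE : IsG32Basis E) (u v : L) :
    E.repr ⁅u, v⁆ 0 = E.repr u 2 * (E.repr v 0 - E.repr v 1)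
        - E.repr v 2 * (E.repr u 0 - E.repr u 1) := by
  rw [hE.lie_eq]; simp

lemma IsG32Basis.repr_lie_one (hE : IsG32Basis E) (u v : L) :
    E.repr ⁅u, v⁆ 1 = E.repr u 2 * E.repr v 1 - E.repr v 2 * E.repr u 1 := by
  rw [hE.lie_eq]; simp

lemma IsG32Basis.repr_lie_two (hE : IsG32Basis E) (u v : L) : E.repr ⁅u, v⁆ 2 = 0 := by
  rw [hE.lie_eq]; simp

/-- A Lie algebra of type `𝔤_{3,2}` has trivial centre. -/
lemma IsG32Basis.eq_zero_of_lie_eq_zero (hE : IsG32Basis E) {w : L} (h : ∀ v : L, ⁅w, v⁆ = 0) :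
    w = 0 := by
  -- Bracketing with `E 0` reads off the coordinate `w₂`; bracketing with `E 2` gives `w₁` and `w₀ -
  -- w₁`, up to sign.
  have h0 := hE.repr_lie_zero w (E 0)
  have h1 := hE.repr_lie_one w (E 2)
  have h2 := hE.repr_lie_zero w (E 2)
  simp [h] at h0 h1 h2
  apply E.repr.injective
  ext i
  fin_cases i <;> simp <;> linarith

/-- The derivations of a Lie algebra of type `𝔤_{3,2}` in the coordinates of an adapted basis. -/
lemma IsG32Basis.toMatrix_derivation (hE : IsG32Basis E) (D : LieDerivation ℝ L L) :
    LinearMap.toMatrix E E (D : L →ₗ[ℝ] L) =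
      !![E.repr (D (E 0)) 0, E.repr (D (E 1)) 0, E.repr (D (E 2)) 0;
        0, E.repr (D (E 0)) 0, E.repr (D (E 2)) 1; 0, 0, 0] := by
  have h20 : ⁅E 2, E 0⁆ = E 0 := by simpa using hE.lie_three_one
  have h12 : ⁅E 1, E 2⁆ = E 0 - E 1 := by simpa using hE.lie_two_three
  -- The two nonzero bracket relations already determine the shape of the matrix.
  have e1 : D (E 0) = ⁅E 2, D (E 0)⁆ - ⁅E 0, D (E 2)⁆ := by
    conv_lhs => rw [← h20, D.apply_lie_eq_sub]
  have e2 : D (E 0) - D (E 1) = ⁅E 1, D (E 2)⁆ - ⁅E 2, D (E 1)⁆ := by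
    rw [← map_sub, ← h12, D.apply_lie_eq_sub]
  have a0 := congrArg (fun x => E.repr x 0) e1
  have a1 := congrArg (fun x => E.repr x 1) e1
  have a2 := congrArg (fun x => E.repr x 2) e1
  have b0 := congrArg (fun x => E.repr x 0) e2
  have b1 := congrArg (fun x => E.repr x 1) e2
  have b2 := congrArg (fun x => E.repr x 2) e2
  simp [hE.repr_lie_zero, hE.repr_lie_one, hE.repr_lie_two]
    at a0 a1 a2 b0 b1 b2
  ext i j
  fin_cases i <;> fin_cases j <;> simp [LinearMap.toMatrix_apply] <;> linarith

/-- The derivation of a Lie algebra of type `𝔤_{3,2}` with prescribed matrix. -/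
lemma IsG32Basis.exists_derivation (hE : IsG32Basis E) (α x₂ x₃ y₃ : ℝ) :
    ∃ D : LieDerivation ℝ L L,
      LinearMap.toMatrix E E (D : L →ₗ[ℝ] L) = !![α, x₂, x₃; 0, α, y₃; 0, 0, 0] := by
  set f : L →ₗ[ℝ] L := Matrix.toLin E E !![α, x₂, x₃; 0, α, y₃; 0, 0, 0] with hf
  have hrepr (v : L) : ⇑(E.repr (f v)) =
      ![α * E.repr v 0 + x₂ * E.repr v 1 + x₃ * E.repr v 2,
        α * E.repr v 1 + y₃ * E.repr v 2, 0] := by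
    rw [hf, Matrix.repr_toLin]
    ext i
    fin_cases i <;> simp [Matrix.mulVec, dotProduct, Fin.sum_univ_three]
  refine ⟨⟨f, fun a b => ?_⟩, ?_⟩
  · apply E.repr.injective
    ext i
    fin_cases i <;>
      simp [hrepr, hE.repr_lie_zero, hE.repr_lie_one, hE.repr_lie_two] <;> ring
  · exact LinearMap.toMatrix_toLin E E _

lemma charpoly_derivation_matrix (α x₂ x₃ y₃ : ℝ) :
    (!![α, x₂, x₃; 0, α, y₃; 0, 0, 0] : Matrix (Fin 3) (Fin 3) ℝ).charpoly =
      Polynomial.X * (Polynomial.X - Polynomial.C α) ^ 2 := by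
  simp [Matrix.charpoly, Matrix.det_fin_three]
  ring

/-- An injective linear map preserving the bracket of a Lie algebra of type `𝔤_{3,2}`, in the
coordinates of an adapted basis. -/
lemma IsG32Basis.toMatrix_automorphism (hE : IsG32Basis E) {B : L →ₗ[ℝ] L}
    (hB : Function.Injective B) (hlie : ∀ u v, B ⁅u, v⁆ = ⁅B u, B v⁆) :
    ∃ a x y z : ℝ, a ≠ 0 ∧ LinearMap.toMatrix E E B = !![a, x, y; 0, a, z; 0, 0, 1] := by
  have h20 : ⁅E 2, E 0⁆ = E 0 := by simpa using hE.lie_three_one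
  have h12 : ⁅E 1, E 2⁆ = E 0 - E 1 := by simpa using hE.lie_two_three
  have e1 : B (E 0) = ⁅B (E 2), B (E 0)⁆ := by rw [← hlie, h20]
  have e2 : B (E 0) - B (E 1) = ⁅B (E 1), B (E 2)⁆ := by rw [← hlie, h12, map_sub]
  have a0 := congrArg (fun x => E.repr x 0) e1
  have a1 := congrArg (fun x => E.repr x 1) e1
  have a2 := congrArg (fun x => E.repr x 2) e1
  have b0 := congrArg (fun x => E.repr x 0) e2
  have b1 := congrArg (fun x => E.repr x 1) e2
  have b2 := congrArg (fun x => E.repr x 2) e2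
  simp [hE.repr_lie_zero, hE.repr_lie_one, hE.repr_lie_two] at a0 a1 a2 b0 b1 b2
  have hne : B (E 0) ≠ 0 := fun h => E.ne_zero 0 (hB (by rw [h, map_zero]))
  rw [a2] at a0 a1 b2
  -- `B (E 0) = ⁅B (E 2), B (E 0)⁆` makes `1 - c`, with `c` this coordinate, annihilate first `y₁`
  -- and then `y₀`, the remaining coordinates of `B (E 0)`; if `c ≠ 1`, then `B (E 0) = 0`.
  have hc : E.repr (B (E 2)) 2 = 1 := by
    by_contra hc
    have hc' : 1 - E.repr (B (E 2)) 2 ≠ 0 := fun h => hc (by linarith)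
    have z1 : E.repr (B (E 0)) 1 = 0 :=
      (mul_eq_zero.mp (show (1 - E.repr (B (E 2)) 2) * E.repr (B (E 0)) 1 = 0 by
        linarith)).resolve_left hc'
    have z0 : E.repr (B (E 0)) 0 = 0 := by
      rw [z1] at a0
      exact (mul_eq_zero.mp (show (1 - E.repr (B (E 2)) 2) * E.repr (B (E 0)) 0 = 0 by
        linarith)).resolve_left hc'
    refine hne (E.repr.injective ?_)
    ext i
    fin_cases i <;> simp [z0, z1, a2]
  have h32 : E.repr (B (E 1)) 2 = 0 := by linarith
  rw [hc, h32] at b0 b1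
  rw [hc] at a0
  have h21 : E.repr (B (E 0)) 1 = 0 := by linarith
  refine ⟨E.repr (B (E 0)) 0, E.repr (B (E 1)) 0, E.repr (B (E 2)) 0, E.repr (B (E 2)) 1,
    fun h0 => hne (E.repr.injective ?_), ?_⟩
  · ext i
    fin_cases i <;> simp [h0, h21, a2]
  · ext i j
    fin_cases i <;> fin_cases j <;> simp [LinearMap.toMatrix_apply] <;> linarith

end Bracket

/-- In the matrix group of automorphisms, an element with positive diagonal commutes with everything
that its square commutes with. -/
lemma commute_of_commute_mul_self {b x y z m p q r : ℝ} (hb : 0 < b)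
    (h : Commute ((!![b, x, y; 0, b, z; 0, 0, 1] : Matrix (Fin 3) (Fin 3) ℝ) *
      !![b, x, y; 0, b, z; 0, 0, 1]) !![m, p, q; 0, m, r; 0, 0, 1]) :
    Commute (!![b, x, y; 0, b, z; 0, 0, 1] : Matrix (Fin 3) (Fin 3) ℝ)
      !![m, p, q; 0, m, r; 0, 0, 1] := by
  have hb' : b + 1 ≠ 0 := by positivity
  have h12 := congrFun (congrFun h.eq 1) 2
  have h02 := congrFun (congrFun h.eq 0) 2
  simp [Matrix.mul_apply, Fin.sum_univ_three] at h12 h02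
  -- Let `U`, `V` be the upper left blocks (they commute) and `w`, `s` the last columns. Commutation
  -- of the matrices is `d = (U - 1) s - (V - 1) w = 0`, while the hypothesis is `(U + 1) d = 0`.
  -- Since `U + 1` is triangular with diagonal `b + 1 ≠ 0`, back substitution gives `d = 0`.
  have k12 : (b - 1) * r - (m - 1) * z = 0 := by
    refine (mul_eq_zero.mp ?_).resolve_left hb'
    linear_combination h12
  have k02 : (b - 1) * q + x * r - (m - 1) * y - p * z = 0 := by
    refine (mul_eq_zero.mp ?_).resolve_left hb'
    linear_combination h02 - x * k12
  refine Matrix.ext fun i j => ?_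
  fin_cases i <;> fin_cases j <;> simp [Matrix.mul_apply, Fin.sum_univ_three]
  · ring
  · ring
  · linear_combination k02
  · ring
  · linear_combination k12

/-- If `B` is the square of an automorphism and `B * B` commutes with the automorphism `M`, then so
does `B`. -/
lemma IsG32Basis.commute_of_commute_mul_self {L : Type*} [LieRing L] [LieAlgebra ℝ L]
    {E : Module.Basis (Fin 3) ℝ L} (hE : IsG32Basis E) {A B M : L →ₗ[ℝ] L} (hAB : A * A = B)
    (hA : Function.Injective A) (hAlie : ∀ u v, A ⁅u, v⁆ = ⁅A u, A v⁆)
    (hM : Function.Injective M) (hMlie : ∀ u v, M ⁅u, v⁆ = ⁅M u, M v⁆)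
    (h : Commute (B * B) M) : Commute B M := by
  obtain ⟨a, x, y, z, ha, hAm⟩ := hE.toMatrix_automorphism hA hAlie
  obtain ⟨m, p, q, r, -, hMm⟩ := hE.toMatrix_automorphism hM hMlie
  -- Being a square, `B` has diagonal entry `a ^ 2 > 0`, whatever the sign of `a`.
  have hBm : LinearMap.toMatrix E E B =
      !![a ^ 2, 2 * a * x, a * y + x * z + y; 0, a ^ 2, a * z + z; 0, 0, 1] := by
    rw [← hAB, LinearMap.toMatrix_mul, hAm]
    ext i j
    fin_cases i <;> fin_cases j <;> simp [Matrix.mul_apply, Fin.sum_univ_three] <;> ring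
  have h' := congrArg (LinearMap.toMatrix E E) h.eq
  simp only [LinearMap.toMatrix_mul, hBm, hMm] at h'
  apply (LinearMap.toMatrix E E).injective
  simp only [LinearMap.toMatrix_mul, hBm, hMm]
  exact (_root_.commute_of_commute_mul_self (by positivity) h').eq

end Algebra

/-! ### Differentials of Lie group automorphisms. -/

section Differential

open VectorField

variable {E : Type*} [NormedAddCommGroup E] [NormedSpace ℝ E]
  {H : Type*} [TopologicalSpace H] {I : ModelWithCorners ℝ E H}
  {G : Type*} [TopologicalSpace G] [ChartedSpace H G] [Group G]

variable (I) in
/-- The differential at `1` of a self-map of a Lie group fixing `1`, as an endomorphism of the Lie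
algebra. -/
noncomputable def differentialOne (ψ : G → G) :
    GroupLieAlgebra I G →ₗ[ℝ] GroupLieAlgebra I G where
  toFun v := mfderiv I I ψ 1 v
  map_add' := map_add (mfderiv I I ψ 1)
  map_smul' := map_smul (mfderiv I I ψ 1)

lemma differentialOne_apply (ψ : G → G) (v : GroupLieAlgebra I G) :
    differentialOne I ψ v = mfderiv I I ψ 1 v := rfl

lemma differentialOne_id : differentialOne I (id : G → G) = 1 := by
  ext v
  rw [differentialOne_apply, mfderiv_id]
  rfl

lemma differentialOne_comp {ψ χ : G → G} (hψ : ContMDiff I I ∞ ψ) (hχ : ContMDiff I I ∞ χ)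
    (h1 : χ 1 = 1) : differentialOne I (ψ ∘ χ) = differentialOne I ψ * differentialOne I χ := by
  ext v
  have h2 : MDifferentiableAt I I ψ (χ 1) := hψ.mdifferentiable (by simp) _
  rw [differentialOne_apply, mfderiv_comp 1 h2 (hχ.mdifferentiable (by simp) _), h1]
  rfl

lemma IsLieGroupAutomorphism.contMDiff {ψ : G → G} (h : IsLieGroupAutomorphism I ψ) :
    ContMDiff I I ∞ ψ := by
  obtain ⟨e, rfl, he, -⟩ := h
  exact he

lemma IsLieGroupAutomorphism.map_mul {ψ : G → G} (h : IsLieGroupAutomorphism I ψ) (a b : G) :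
    ψ (a * b) = ψ a * ψ b := by
  obtain ⟨e, rfl, -⟩ := h
  exact _root_.map_mul e a b

lemma IsLieGroupAutomorphism.map_one {ψ : G → G} (h : IsLieGroupAutomorphism I ψ) : ψ 1 = 1 := by
  obtain ⟨e, rfl, -⟩ := h
  exact _root_.map_one e

lemma IsLieGroupAutomorphism.map_inv {ψ : G → G} (h : IsLieGroupAutomorphism I ψ) (a : G) :
    ψ a⁻¹ = (ψ a)⁻¹ := by
  obtain ⟨e, rfl, -⟩ := h
  exact _root_.map_inv e a

lemma IsLieGroupAutomorphism.differentialOne_injective {ψ : G → G}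
    (h : IsLieGroupAutomorphism I ψ) : Function.Injective (differentialOne I ψ) := by
  have h1 := h.map_one
  obtain ⟨e, rfl, he, he'⟩ := h
  have : differentialOne I e.symm * differentialOne I e = 1 := by
    rw [← differentialOne_comp he' he h1, e.symm_comp_self, differentialOne_id]
  exact Function.LeftInverse.injective (g := differentialOne I e.symm)
    fun v => LinearMap.congr_fun this v

/-- Needed because `mpullback` is defined through `ContinuousLinearMap.inverse`, which is meaningful
only for invertible maps. -/
lemma IsLieGroupAutomorphism.isInvertible_mfderiv {ψ : G → G}
    (h : IsLieGroupAutomorphism I ψ) (g : G) : (mfderiv I I ψ g).IsInvertible := by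
  obtain ⟨e, rfl, he, he'⟩ := h
  have d := he.mdifferentiable (by simp)
  have d' := he'.mdifferentiable (by simp)
  refine ContinuousLinearMap.IsInvertible.of_inverse (g := mfderiv I I e.symm (e g)) ?_ ?_
  · have := mfderiv_comp (I' := I) (e g) (d (e.symm (e g))) (d' (e g))
    rw [e.self_comp_symm, mfderiv_id, e.symm_apply_apply] at this
    exact this.symm
  · have := mfderiv_comp (I' := I) g (d' (e g)) (d g)
    rw [e.symm_comp_self, mfderiv_id] at this
    exact this.symm

variable [LieGroup I (minSmoothness ℝ 3) G]

lemma mdifferentiable_mul_left_lieGroup (g : G) : MDifferentiable I I (fun x : G => g * x) :=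
  (contMDiff_mul_left (I := I) (n := minSmoothness ℝ 3)).mdifferentiable (by simp)

lemma mdifferentiable_mul_right_lieGroup (g : G) : MDifferentiable I I (fun x : G => x * g) :=
  (contMDiff_mul_right (I := I) (n := minSmoothness ℝ 3)).mdifferentiable (by simp)

/-- Differentiate `ψ ∘ L_g = L_{ψ g} ∘ ψ` at `1`. -/
lemma IsLieGroupAutomorphism.mfderiv_mulInvariantVectorField {ψ : G → G}
    (h : IsLieGroupAutomorphism I ψ) (v : GroupLieAlgebra I G) (g : G) :
    mfderiv I I ψ g (mulInvariantVectorField v g) =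
      mulInvariantVectorField (differentialOne I ψ v) (ψ g) := by
  have d := h.contMDiff.mdifferentiable (by simp)
  have hc : ψ ∘ (fun x => g * x) = (fun x => ψ g * x) ∘ ψ := funext fun x => h.map_mul g x
  have l := mfderiv_comp (I' := I) 1 (d (g * 1)) (mdifferentiable_mul_left_lieGroup (I := I) g 1)
  have r := mfderiv_comp (I' := I) 1 (mdifferentiable_mul_left_lieGroup (I := I) (ψ g) (ψ 1)) (d 1)
  rw [hc, r, mul_one, h.map_one] at l
  exact (DFunLike.congr_fun l v).symm

/-- The differential of a Lie group automorphism preserves the Lie bracket. -/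
lemma IsLieGroupAutomorphism.differentialOne_lie [CompleteSpace E] {ψ : G → G}
    (h : IsLieGroupAutomorphism I ψ) (v w : GroupLieAlgebra I G) :
    differentialOne I ψ ⁅v, w⁆ = ⁅differentialOne I ψ v, differentialOne I ψ w⁆ := by
  -- Left-invariant fields pull back to left-invariant fields, so naturality of the bracket of
  -- vector fields, evaluated at `1`, gives the claim.
  have hpull (u : GroupLieAlgebra I G) :
      mpullback I I ψ (mulInvariantVectorField (differentialOne I ψ u)) =
        mulInvariantVectorField u := by
    ext g
    rw [mpullback_apply, ← h.mfderiv_mulInvariantVectorField]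
    exact DFunLike.congr_fun (h.isInvertible_mfderiv g).inverse_comp_self _
  have key := mpullback_mlieBracket (n := ∞) (I := I) (I' := I) (f := ψ) (x₀ := 1)
    (mdifferentiableAt_mulInvariantVectorField (differentialOne I ψ v))
    (mdifferentiableAt_mulInvariantVectorField (differentialOne I ψ w))
    h.contMDiff.contMDiffAt
    (by rw [minSmoothness_of_isRCLikeNormedField]; exact ENat.LEInfty.out)
  rw [hpull, hpull, mpullback_apply, h.map_one] at key
  rw [GroupLieAlgebra.bracket_def, GroupLieAlgebra.bracket_def, ← key, differentialOne_apply]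
  exact DFunLike.congr_fun (h.isInvertible_mfderiv 1).self_comp_inverse _

end Differential

/-! ### Multiplication in a chart at `1`, and the bracket as a second derivative. -/

section Chart

open VectorField Filter Topology

variable {E : Type*} [NormedAddCommGroup E] [NormedSpace ℝ E]
  {H : Type*} [TopologicalSpace H] {I : ModelWithCorners ℝ E H}
  {G : Type*} [TopologicalSpace G] [ChartedSpace H G] [Group G]
  [LieGroup I (minSmoothness ℝ 3) G]

variable (I G) in
/-- The multiplication of a Lie group, read in the preferred chart at `1`. -/
noncomputable def mulInChart (q : E × E) : E :=
  extChartAt I (1 : G) ((extChartAt I (1 : G)).symm q.1 * (extChartAt I (1 : G)).symm q.2)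

lemma contDiffAt_mulInChart [I.Boundaryless] :
    ContDiffAt ℝ (minSmoothness ℝ 3) (mulInChart I G)
      (extChartAt I (1 : G) 1, extChartAt I (1 : G) 1) := by
  set p := extChartAt I (1 : G) 1
  have hs : ContMDiffAt 𝓘(ℝ, E) I (minSmoothness ℝ 3) (extChartAt I (1 : G)).symm p :=
    (contMDiffOn_extChartAt_symm (1 : G)).contMDiffAt (extChartAt_target_mem_nhds (I := I) (1 : G))
  have hps : (extChartAt I (1 : G)).symm p = 1 := extChartAt_to_inv (I := I) (1 : G)
  have h1 : ContMDiffAt 𝓘(ℝ, E × E) I (minSmoothness ℝ 3)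
      (fun q : E × E => (extChartAt I (1 : G)).symm q.1) (p, p) :=
    ContMDiffAt.comp (p, p) (g := (extChartAt I (1 : G)).symm) hs
      contDiffAt_fst.contMDiffAt
  have h2 : ContMDiffAt 𝓘(ℝ, E × E) I (minSmoothness ℝ 3)
      (fun q : E × E => (extChartAt I (1 : G)).symm q.2) (p, p) :=
    ContMDiffAt.comp (p, p) (g := (extChartAt I (1 : G)).symm) hs
      contDiffAt_snd.contMDiffAt
  have h3 := h1.mul h2
  have he : ContMDiffAt I 𝓘(ℝ, E) (minSmoothness ℝ 3) (extChartAt I (1 : G))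
      ((extChartAt I (1 : G)).symm p * (extChartAt I (1 : G)).symm p) := by
    rw [hps, one_mul]
    exact contMDiffAt_extChartAt
  exact contMDiffAt_iff_contDiffAt.mp (ContMDiffAt.comp (p, p) he h3)

lemma eventually_differentiableAt_mulInChart [I.Boundaryless] :
    ∀ᶠ q in 𝓝 (extChartAt I (1 : G) 1, extChartAt I (1 : G) 1),
      DifferentiableAt ℝ (mulInChart I G) q :=
  ((contDiffAt_mulInChart (I := I) (G := G)).eventually (by simp)).mono
    fun _ hq => hq.differentiableAt (by simp)

/-- Left translations in the chart at `1`. -/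
lemma mfderiv_extChartAt_mulInvariantVectorField {g : G} (hg : g ∈ (extChartAt I (1 : G)).source)
    (hd : DifferentiableAt ℝ (mulInChart I G) (extChartAt I (1 : G) g, extChartAt I (1 : G) 1))
    (v : GroupLieAlgebra I G) :
    mfderiv I 𝓘(ℝ, E) (extChartAt I (1 : G)) g (mulInvariantVectorField v g) =
      fderiv ℝ (mulInChart I G) (extChartAt I (1 : G) g, extChartAt I (1 : G) 1)
        (0, mfderiv I 𝓘(ℝ, E) (extChartAt I (1 : G)) 1 v) := by
  have : IsManifold I 1 G := IsManifold.of_le (n := minSmoothness ℝ 3) (by simp)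
  set e := extChartAt I (1 : G)
  have he (x : G) (hx : x ∈ e.source) : MDifferentiableAt I 𝓘(ℝ, E) e x :=
    mdifferentiableAt_extChartAt (by simpa [e] using hx)
  have ha : HasFDerivAt (fun b => mulInChart I G (e g, b))
      ((fderiv ℝ (mulInChart I G) (e g, e 1)).comp (ContinuousLinearMap.inr ℝ E E)) (e 1) :=
      HasFDerivAt.comp (g := mulInChart I G) (e 1) hd.hasFDerivAt
        (hasFDerivAt_prodMk_right (e g) (e 1))
  have h1 := HasMFDerivAt.comp (g := fun b => mulInChart I G (e g, b)) (f := e) (1 : G)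
    ha.hasMFDerivAt (he 1 (mem_extChartAt_source 1)).hasMFDerivAt
  have h2 : HasMFDerivAt I 𝓘(ℝ, E) (fun x => e (g * x)) 1
      ((mfderiv I 𝓘(ℝ, E) e (g * 1)).comp (mfderiv I I (fun x => g * x) 1)) :=
    HasMFDerivAt.comp (1 : G) (he (g * 1) (by rwa [mul_one])).hasMFDerivAt
      (mdifferentiable_mul_left_lieGroup g 1).hasMFDerivAt
  have heq : (fun x => mulInChart I G (e g, e x)) =ᶠ[𝓝 1] fun x => e (g * x) := by
    filter_upwards [extChartAt_source_mem_nhds (I := I) (1 : G)] with x hx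
    simp only [mulInChart]
    rw [e.left_inv hg, e.left_inv hx]
  have h3 := hasMFDerivAt_unique h1 (h2.congr_of_eventuallyEq heq)
  have h4 := DFunLike.congr_fun h3 v
  rw [mul_one] at h4
  exact h4.symm

/-- Right translations in the chart at `1`. -/
lemma mfderiv_extChartAt_mfderiv_mul_right {g : G} (hg : g ∈ (extChartAt I (1 : G)).source)
    (hd : DifferentiableAt ℝ (mulInChart I G) (extChartAt I (1 : G) 1, extChartAt I (1 : G) g))
    (v : GroupLieAlgebra I G) :
    mfderiv I 𝓘(ℝ, E) (extChartAt I (1 : G)) g (mfderiv I I (fun x => x * g) (1 : G) v) =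
      fderiv ℝ (mulInChart I G) (extChartAt I (1 : G) 1, extChartAt I (1 : G) g)
        (mfderiv I 𝓘(ℝ, E) (extChartAt I (1 : G)) 1 v, 0) := by
  have : IsManifold I 1 G := IsManifold.of_le (n := minSmoothness ℝ 3) (by simp)
  set e := extChartAt I (1 : G)
  have he (x : G) (hx : x ∈ e.source) : MDifferentiableAt I 𝓘(ℝ, E) e x :=
    mdifferentiableAt_extChartAt (by simpa [e] using hx)
  have ha : HasFDerivAt (fun b => mulInChart I G (b, e g))
      ((fderiv ℝ (mulInChart I G) (e 1, e g)).comp (ContinuousLinearMap.inl ℝ E E)) (e 1) :=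
      HasFDerivAt.comp (g := mulInChart I G) (f := fun b => (b, e g)) (e 1) hd.hasFDerivAt
        (hasFDerivAt_prodMk_left (e 1) (e g))
  have h1 := HasMFDerivAt.comp (g := fun b => mulInChart I G (b, e g)) (f := e) (1 : G)
    ha.hasMFDerivAt (he 1 (mem_extChartAt_source 1)).hasMFDerivAt
  have h2 : HasMFDerivAt I 𝓘(ℝ, E) (fun x => e (x * g)) 1
      ((mfderiv I 𝓘(ℝ, E) e (1 * g)).comp (mfderiv I I (fun x => x * g) 1)) :=
    HasMFDerivAt.comp (1 : G) (he (1 * g) (by rwa [one_mul])).hasMFDerivAt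
      (mdifferentiable_mul_right_lieGroup g 1).hasMFDerivAt
  have heq : (fun x => mulInChart I G (e x, e g)) =ᶠ[𝓝 1] fun x => e (x * g) := by
    filter_upwards [extChartAt_source_mem_nhds (I := I) (1 : G)] with x hx
    simp only [mulInChart]
    rw [e.left_inv hg, e.left_inv hx]
  have h3 := hasMFDerivAt_unique h1 (h2.congr_of_eventuallyEq heq)
  have h4 := DFunLike.congr_fun h3 v
  rw [one_mul] at h4
  exact h4.symm

/-- Left-invariant vector fields in the chart at `1`. -/
lemma mpullbackWithin_mulInvariantVectorField_eventuallyEq [I.Boundaryless]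
    (v : GroupLieAlgebra I G) :
    mpullbackWithin 𝓘(ℝ, E) I (extChartAt I (1 : G)).symm (mulInvariantVectorField v)
        (Set.range I) =ᶠ[𝓝 (extChartAt I (1 : G) 1)]
      fun a => fderiv ℝ (mulInChart I G) (a, extChartAt I (1 : G) 1)
        (0, mfderiv I 𝓘(ℝ, E) (extChartAt I (1 : G)) 1 v) := by
  have : IsManifold I 1 G := IsManifold.of_le (n := minSmoothness ℝ 3) (by simp)
  have hd := (Continuous.prodMk_left (extChartAt I (1 : G) 1)).continuousAt.eventually
    (eventually_differentiableAt_mulInChart (I := I) (G := G))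
  filter_upwards [extChartAt_target_mem_nhds (I := I) (1 : G), hd] with a ha hda
  rw [mpullbackWithin_apply]
  have hinv : (mfderivWithin 𝓘(ℝ, E) I (extChartAt I (1 : G)).symm (Set.range I) a).inverse =
      mfderiv I 𝓘(ℝ, E) (extChartAt I (1 : G)) ((extChartAt I (1 : G)).symm a) :=
    ContinuousLinearMap.inverse_eq
      (mfderivWithin_extChartAt_symm_comp_mfderiv_extChartAt ha)
      (mfderiv_extChartAt_comp_mfderivWithin_extChartAt_symm ha)
  have hra : extChartAt I (1 : G) ((extChartAt I (1 : G)).symm a) = a :=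
    (extChartAt I (1 : G)).right_inv ha
  rw [hinv]
  refine (mfderiv_extChartAt_mulInvariantVectorField ((extChartAt I (1 : G)).map_target ha)
    (by rwa [hra]) v).trans ?_
  rw [hra]

/-- If the left and right translates of `v` agree along a curve through `1` with velocity `w`, then
`w` and `v` commute. -/
lemma lie_eq_zero_of_hasDerivAt [I.Boundaryless] {h : ℝ → G} (h0 : h 0 = 1) (hc : ContinuousAt h 0)
    {v w : GroupLieAlgebra I G}
    (hw : HasDerivAt (fun t => extChartAt I (1 : G) (h t))
      (mfderiv I 𝓘(ℝ, E) (extChartAt I (1 : G)) 1 w) 0)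
    (hv : ∀ t, mulInvariantVectorField v (h t) = mfderiv I I (fun x => x * h t) (1 : G) v) :
    ⁅w, v⁆ = 0 := by
  set e := extChartAt I (1 : G)
  set p := e 1
  set μ := mulInChart I G
  set v' : E := mfderiv I 𝓘(ℝ, E) e 1 v
  set w' : E := mfderiv I 𝓘(ℝ, E) e 1 w
  have h2 : ContDiffAt ℝ (minSmoothness ℝ 3) μ (p, p) := contDiffAt_mulInChart
  have hD : HasFDerivAt (fderiv ℝ μ) (fderiv ℝ (fderiv ℝ μ) (p, p)) (p, p) :=
    ((h2.of_le (m := 2) (by simp; norm_num)).fderiv_right (m := 1) (by norm_num)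
      |>.differentiableAt (by simp)).hasFDerivAt
  have hsymm : IsSymmSndFDerivAt ℝ μ (p, p) :=
    h2.isSymmSndFDerivAt (minSmoothness_monotone (by norm_num))
  -- Both sides are derivatives at `t = 0` of the chart expressions of the left and right translates
  -- of `v` to `h t`, which agree for `t` near `0`.
  have hcurve : fderiv ℝ (fderiv ℝ μ) (p, p) (w', 0) (0, v') =
      fderiv ℝ (fderiv ℝ μ) (p, p) (0, w') (v', 0) := by
    have hc0 : e (h 0) = p := by rw [h0]
    have l : HasDerivAt (fun t => fderiv ℝ μ (e (h t), p) (0, v'))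
        (fderiv ℝ (fderiv ℝ μ) (p, p) (w', 0) (0, v')) 0 := by
      have := HasFDerivAt.comp_hasDerivAt_of_eq (0 : ℝ) hD
        (hw.prodMk (hasDerivAt_const (0 : ℝ) p)) (by rw [hc0])
      exact this.clm_apply (hasDerivAt_const _ _) |>.congr_deriv (by simp)
    have r : HasDerivAt (fun t => fderiv ℝ μ (p, e (h t)) (v', 0))
        (fderiv ℝ (fderiv ℝ μ) (p, p) (0, w') (v', 0)) 0 := by
      have := HasFDerivAt.comp_hasDerivAt_of_eq (0 : ℝ) hD
        ((hasDerivAt_const (0 : ℝ) p).prodMk hw) (by rw [hc0])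
      exact this.clm_apply (hasDerivAt_const _ _) |>.congr_deriv (by simp)
    refine l.unique (r.congr_of_eventuallyEq ?_)
    have hdiff := eventually_differentiableAt_mulInChart (I := I) (G := G)
    have cl : Tendsto (fun t => (e (h t), p)) (𝓝 0) (𝓝 (p, p)) := by
      have := hw.continuousAt.tendsto
      rw [hc0] at this
      exact this.prodMk_nhds tendsto_const_nhds
    have cr : Tendsto (fun t => (p, e (h t))) (𝓝 0) (𝓝 (p, p)) := by
      have := hw.continuousAt.tendsto
      rw [hc0] at this
      exact tendsto_const_nhds.prodMk_nhds this
    have hs : ∀ᶠ t in 𝓝 0, h t ∈ e.source :=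
      hc.eventually_mem (by rw [h0]; exact extChartAt_source_mem_nhds (I := I) (1 : G))
    filter_upwards [hs, cl.eventually hdiff, cr.eventually hdiff] with t ht dl dr
    rw [← mfderiv_extChartAt_mulInvariantVectorField ht dl v, hv t,
      mfderiv_extChartAt_mfderiv_mul_right ht dr v]
  have hfield (u : E) : HasFDerivAt (fun a => fderiv ℝ μ (a, p) (0, u))
      (((ContinuousLinearMap.apply ℝ E ((0 : E), u)).comp (fderiv ℝ (fderiv ℝ μ) (p, p))).comp
        (ContinuousLinearMap.inl ℝ E E)) p :=
    HasFDerivAt.comp (f := fun a => (a, p)) p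
      ((ContinuousLinearMap.apply ℝ E ((0 : E), u)).hasFDerivAt.comp (p, p) hD)
      (hasFDerivAt_prodMk_left p p)
  -- Left translation by `1` is the identity.
  have hval (u : GroupLieAlgebra I G) :
      fderiv ℝ μ (p, p) (0, mfderiv I 𝓘(ℝ, E) e 1 u) = mfderiv I 𝓘(ℝ, E) e 1 u := by
    rw [← mfderiv_extChartAt_mulInvariantVectorField (mem_extChartAt_source 1)
      eventually_differentiableAt_mulInChart.self_of_nhds u]
    have h1 : (fun x : G => 1 * x) = id := funext one_mul
    have h2 : mulInvariantVectorField u (1 : G) = u := by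
      rw [mulInvariantVectorField, h1, mfderiv_id]
      rfl
    rw [h2]
  have hbracket (V W : E → E)
      (hV : V =ᶠ[𝓝 p] fun a => fderiv ℝ μ (a, p) (0, v'))
      (hW : W =ᶠ[𝓝 p] fun a => fderiv ℝ μ (a, p) (0, w')) :
      lieBracketWithin ℝ W V Set.univ p = 0 := by
    rw [lieBracketWithin_univ, lieBracket_eq]
    beta_reduce
    rw [hV.fderiv_eq, hW.fderiv_eq, hV.eq_of_nhds, hW.eq_of_nhds, (hfield _).fderiv,
      (hfield _).fderiv, sub_eq_zero]
    rw [show fderiv ℝ μ (p, p) (0, v') = v' from hval v,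
      show fderiv ℝ μ (p, p) (0, w') = w' from hval w]
    -- The bracket has become `D²μ (w', 0) (0, v') - D²μ (v', 0) (0, w')`; `hcurve` and the symmetry
    -- of `D²μ` make it vanish.
    exact hcurve.trans (hsymm _ _)
  have hzero := hbracket _ _ (mpullbackWithin_mulInvariantVectorField_eventuallyEq v)
    (mpullbackWithin_mulInvariantVectorField_eventuallyEq w)
  rw [GroupLieAlgebra.bracket_def, ← mlieBracketWithin_univ, mlieBracketWithin_apply,
    Set.preimage_univ, Set.univ_inter]
  rw [ModelWithCorners.range_eq_univ] at hzero ⊢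
  exact (congrArg _ hzero).trans (ContinuousLinearMap.map_zero _)

end Chart

/-! ### The adjoint representation and its infinitesimal kernel. -/

section Adjoint

open Bundle Filter Topology

variable {E : Type*} [NormedAddCommGroup E] [NormedSpace ℝ E]
  {H : Type*} [TopologicalSpace H] {I : ModelWithCorners ℝ E H}
  {G : Type*} [TopologicalSpace G] [ChartedSpace H G] [Group G]

variable (I) in
/-- The adjoint representation of a Lie group on its Lie algebra. -/
noncomputable def adjointMap (g : G) : GroupLieAlgebra I G →ₗ[ℝ] GroupLieAlgebra I G :=
  differentialOne I (MulAut.conj g)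

lemma adjointMap_one : adjointMap I (1 : G) = 1 := by
  rw [adjointMap, map_one, MulAut.coe_one, differentialOne_id]

variable [LieGroup I ∞ G]

lemma isLieGroupAutomorphism_conj (g : G) : IsLieGroupAutomorphism I (MulAut.conj g) := by
  have hc (g : G) : ContMDiff I I ∞ (fun x : G => g * x * g⁻¹) :=
    (contMDiff_mul_right (a := g⁻¹)).comp (contMDiff_mul_left (a := g))
  refine ⟨MulAut.conj g, rfl, hc g, ?_⟩
  convert! hc g⁻¹ using 2
  simp

lemma adjointMap_mul (g h : G) : adjointMap I (g * h) = adjointMap I g * adjointMap I h := by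
  rw [adjointMap, map_mul, MulAut.coe_mul,
    differentialOne_comp (isLieGroupAutomorphism_conj g).contMDiff
      (isLieGroupAutomorphism_conj h).contMDiff (map_one _)]
  rfl

/-- Differentiate `c_{ψ g} ∘ ψ = ψ ∘ c_g` at `1`, where `c_g` is conjugation by `g`. -/
lemma IsLieGroupAutomorphism.adjointMap_apply_mul {ψ : G → G} (h : IsLieGroupAutomorphism I ψ)
    (g : G) : adjointMap I (ψ g) * differentialOne I ψ =
      differentialOne I ψ * adjointMap I g := by
  rw [adjointMap, adjointMap,
    ← differentialOne_comp (isLieGroupAutomorphism_conj _).contMDiff h.contMDiff h.map_one,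
    ← differentialOne_comp h.contMDiff (isLieGroupAutomorphism_conj _).contMDiff
      (_root_.map_one _)]
  congr 1
  ext x
  simp [h.map_mul, h.map_inv]

/-- `Ad g v` is the value of the continuous tangent map of `(g, x) ↦ g x g⁻¹` at the vector `(0, v)`
over `(g, 1)`, and the fibre over `1` carries the topology induced from the tangent bundle. -/
lemma continuous_adjointMap_apply (v : GroupLieAlgebra I G) :
    Continuous fun g : G => (adjointMap I g v : TangentSpace I (1 : G)) := by
  let P : G × G → G := fun p => p.1 * p.2 * p.1⁻¹
  have hP : ContMDiff (I.prod I) I ∞ P :=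
    (contMDiff_fst.mul contMDiff_snd).mul contMDiff_fst.inv
  let F₁ : G → TangentBundle I G × TangentBundle I G :=
    fun g => (TotalSpace.mk' E g 0, TotalSpace.mk' E 1 v)
  have S₁ : Continuous F₁ :=
    ((contMDiff_zeroSection (IB := I) (n := 0) ℝ (TangentSpace I : G → Type _)).continuous).prodMk
      continuous_const
  have S₂ : Continuous (equivTangentBundleProd I G I G).symm :=
    (contMDiff_equivTangentBundleProd_symm (n := 0)).continuous
  have S₃ : Continuous (tangentMap (I.prod I) I P) :=
    hP.continuous_tangentMap (by simp)
  rw [(FiberBundle.totalSpaceMk_isInducing E (TangentSpace I) (1 : G)).continuous_iff]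
  convert! (S₃.comp S₂).comp S₁ using 1
  ext g
  · simp [F₁, P, tangentMap]
  · simp only [Function.comp_apply, tangentMap, F₁]
    rw [mfderiv_prod_eq_add_apply (hP.mdifferentiable (by simp) _)]
    apply heq_of_eq
    exact ((congrArg (· + _) (ContinuousLinearMap.map_zero _)).trans (zero_add (M := E) _)).symm

variable [LieGroup I (minSmoothness ℝ 3) G]

lemma mulInvariantVectorField_eq_mfderiv_mul_right (v : GroupLieAlgebra I G) (g : G) :
    mulInvariantVectorField v g = mfderiv I I (fun x => x * g) (1 : G) (adjointMap I g v) := by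
  have hc : (fun x => g * x) = (fun x => x * g) ∘ MulAut.conj g := by
    ext x
    simp
  have h1 := mfderiv_comp (I' := I) (1 : G)
    (mdifferentiable_mul_right_lieGroup (I := I) g (MulAut.conj g 1))
    ((isLieGroupAutomorphism_conj (I := I) g).contMDiff.mdifferentiable (by simp) 1)
  rw [← hc, map_one] at h1
  exact DFunLike.congr_fun h1 v

/-- If a differentiable curve has constant image under the adjoint representation and the centre of
the Lie algebra is trivial, then its initial velocity vanishes. -/
lemma velocity_eq_zero_of_adjointMap_eq [I.Boundaryless] {γ : ℝ → G}
    (hcenter : ∀ w : GroupLieAlgebra I G, (∀ v : GroupLieAlgebra I G, ⁅w, v⁆ = 0) → w = 0)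
    (hγ : ∀ t, adjointMap I (γ t) = adjointMap I (γ 0)) {u : TangentSpace I (γ 0)}
    (hu : HasMFDerivAt 𝓘(ℝ, ℝ) I γ 0 ((1 : ℝ →L[ℝ] ℝ).smulRight u)) : u = 0 := by
  have : IsManifold I 1 G := IsManifold.of_le (n := minSmoothness ℝ 3) (by simp)
  -- Translated to start at `1`, the curve has trivial `Ad`, so left and right translates of every
  -- `v` agree along it and its velocity `w` is central.
  let w : GroupLieAlgebra I G := mfderiv I I (fun x => (γ 0)⁻¹ * x) (γ 0) u
  have hh : HasMFDerivAt 𝓘(ℝ, ℝ) I (fun t => (γ 0)⁻¹ * γ t) 0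
      ((mfderiv I I (fun x => (γ 0)⁻¹ * x) (γ 0)).comp ((1 : ℝ →L[ℝ] ℝ).smulRight u)) :=
    HasMFDerivAt.comp (g := fun x => (γ 0)⁻¹ * x) (0 : ℝ)
      (mdifferentiable_mul_left_lieGroup (γ 0)⁻¹ (γ 0)).hasMFDerivAt hu
  have hw : w = 0 := by
    refine hcenter w fun v => ?_
    refine lie_eq_zero_of_hasDerivAt (h := fun t => (γ 0)⁻¹ * γ t) (inv_mul_cancel (γ 0))
      hh.continuousAt ?_ fun t => ?_
    · have he : MDifferentiableAt I 𝓘(ℝ, E) (extChartAt I (1 : G)) ((γ 0)⁻¹ * γ 0) := by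
        rw [inv_mul_cancel]
        exact mdifferentiableAt_extChartAt (mem_chart_source H 1)
      have hd := HasMFDerivAt.comp (g := extChartAt I (1 : G)) (f := fun t => (γ 0)⁻¹ * γ t) (0 : ℝ)
        he.hasMFDerivAt hh
      have hd' : HasFDerivAt (fun t => extChartAt I (1 : G) ((γ 0)⁻¹ * γ t)) (_ : ℝ →L[ℝ] E) 0 :=
        hasMFDerivAt_iff_hasFDerivAt.mp hd
      refine hd'.hasDerivAt.congr_deriv ?_
      rw [inv_mul_cancel]
      change mfderiv I 𝓘(ℝ, E) (extChartAt I (1 : G)) 1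
        (mfderiv I I (fun x => (γ 0)⁻¹ * x) (γ 0) ((1 : ℝ) • u)) = _
      rw [one_smul]
    · rw [mulInvariantVectorField_eq_mfderiv_mul_right, adjointMap_mul, hγ t, ← adjointMap_mul,
        inv_mul_cancel, adjointMap_one]
      rfl
  have h1 := mfderiv_comp (I' := I) (γ 0)
    (mdifferentiable_mul_left_lieGroup (I := I) (γ 0) ((γ 0)⁻¹ * γ 0))
    (mdifferentiable_mul_left_lieGroup (I := I) (γ 0)⁻¹ (γ 0))
  have h2 : (fun x => γ 0 * x) ∘ (fun x => (γ 0)⁻¹ * x) = id := by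
    ext x
    simp
  rw [h2, mfderiv_id] at h1
  have h3 : u = mfderiv I I (fun x => γ 0 * x) ((γ 0)⁻¹ * γ 0) w := DFunLike.congr_fun h1 u
  rw [h3, hw]
  exact (mfderiv I I (fun x => γ 0 * x) ((γ 0)⁻¹ * γ 0)).map_zero

end Adjoint

/-! ### Linear flows and the times commuting with `Ad g`. -/

section Flow

open Filter Topology

variable {E : Type*} [NormedAddCommGroup E] [NormedSpace ℝ E]
  {H : Type*} [TopologicalSpace H] {I : ModelWithCorners ℝ E H}
  {G : Type*} [TopologicalSpace G] [ChartedSpace H G] [Group G] [LieGroup I ∞ G]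
  {X : (g : G) → TangentSpace I g} {φ : ℝ → G → G}

lemma IsLinearVectorFieldWithFlow.contMDiff_one (h : IsLinearVectorFieldWithFlow I X φ) :
    ContMDiff I I.tangent 1 (fun g => (⟨g, X g⟩ : TangentBundle I G)) :=
  h.smooth.of_le ENat.LEInfty.out

lemma IsLinearVectorFieldWithFlow.flow_zero (h : IsLinearVectorFieldWithFlow I X φ) :
    φ 0 = id := funext h.flow.initial

lemma IsLinearVectorFieldWithFlow.continuous_orbit (h : IsLinearVectorFieldWithFlow I X φ)
    (g : G) : Continuous fun t => φ t g :=
  continuous_iff_continuousAt.mpr fun t => (h.flow.integralCurve g t).continuousAt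

variable [I.Boundaryless] [T2Space G]

lemma IsLinearVectorFieldWithFlow.flow_add (h : IsLinearVectorFieldWithFlow I X φ) (s t : ℝ) :
    φ (s + t) = φ s ∘ φ t := by
  have : IsManifold I 1 G := IsManifold.of_le (n := ∞) ENat.LEInfty.out
  ext g
  have := isMIntegralCurve_Ioo_eq_of_contMDiff_boundaryless (t₀ := 0) h.contMDiff_one
    ((h.flow.integralCurve g).comp_add t) (h.flow.integralCurve (φ t g))
    (by simp [h.flow.initial])
  exact congrFun this s

lemma IsLinearVectorFieldWithFlow.eq_of_eq_zero (h : IsLinearVectorFieldWithFlow I X φ) {g : G}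
    (hg : X g = 0) (t : ℝ) : φ t g = g := by
  have : IsManifold I 1 G := IsManifold.of_le (n := ∞) ENat.LEInfty.out
  have hconst : IsMIntegralCurve (I := I) (fun _ : ℝ => g) X := fun s => by
    have h0 : (1 : ℝ →L[ℝ] ℝ).smulRight (X g) = 0 := by
      rw [hg]
      exact ContinuousLinearMap.ext fun r => smul_zero (A := E) r
    rw [h0]
    exact hasMFDerivAt_const g s
  exact congrFun (isMIntegralCurve_Ioo_eq_of_contMDiff_boundaryless (t₀ := 0) h.contMDiff_one
    (h.flow.integralCurve g) hconst (h.flow.initial g)) t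

lemma IsLinearVectorFieldWithFlow.differentialOne_add (h : IsLinearVectorFieldWithFlow I X φ)
    (s t : ℝ) : differentialOne I (φ (s + t)) =
      differentialOne I (φ s) * differentialOne I (φ t) := by
  rw [h.flow_add, differentialOne_comp (h.automorphism s).contMDiff (h.automorphism t).contMDiff
    (h.automorphism t).map_one]

lemma IsLinearVectorFieldWithFlow.differentialOne_mul_neg
    (h : IsLinearVectorFieldWithFlow I X φ) (t : ℝ) :
    differentialOne I (φ t) * differentialOne I (φ (-t)) = 1 := by
  rw [← h.differentialOne_add, add_neg_cancel, h.flow_zero, differentialOne_id]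

lemma IsLinearVectorFieldWithFlow.commute_iff (h : IsLinearVectorFieldWithFlow I X φ) (t : ℝ)
    (g : G) : Commute (differentialOne I (φ t)) (adjointMap I g) ↔
      adjointMap I (φ t g) = adjointMap I g := by
  have key := (h.automorphism t).adjointMap_apply_mul g
  constructor
  · intro hc
    rw [hc.eq] at key
    have := congrArg (· * differentialOne I (φ (-t))) key
    simpa only [mul_assoc, h.differentialOne_mul_neg, mul_one] using this
  · intro hc
    rw [hc] at key
    exact key.symm

/-- The times at which the differential of a linear flow commutes with `Ad g`. -/
def IsLinearVectorFieldWithFlow.commuteTimes (h : IsLinearVectorFieldWithFlow I X φ) (g : G) :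
    AddSubgroup ℝ where
  carrier := {t | Commute (differentialOne I (φ t)) (adjointMap I g)}
  zero_mem' := by
    rw [Set.mem_ofPred_eq, h.flow_zero, differentialOne_id]
    exact Commute.one_left _
  add_mem' {s t} hs ht := by
    rw [Set.mem_ofPred_eq, h.differentialOne_add]
    exact Commute.mul_left hs ht
  neg_mem' {t} ht := by
    have h1 := h.differentialOne_mul_neg t
    have h2 := h.differentialOne_mul_neg (-t)
    rw [neg_neg] at h2
    exact Commute.units_inv_left (u := ⟨_, _, h1, h2⟩) ht

/-- Rewriting commutation as `Ad (φ t g) = Ad g` means that only the orbit of `g` has to be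
continuous in `t`, not the differential of `φ t`. -/
lemma IsLinearVectorFieldWithFlow.isClosed_commuteTimes
    (h : IsLinearVectorFieldWithFlow I X φ) (g : G) :
    IsClosed (h.commuteTimes g : Set ℝ) := by
  have : (h.commuteTimes g : Set ℝ) =
      ⋂ v : GroupLieAlgebra I G, {t | adjointMap I (φ t g) v = adjointMap I g v} := by
    ext t
    simp only [Set.mem_iInter, Set.mem_ofPred_eq]
    exact (h.commute_iff t g).trans LinearMap.ext_iff
  rw [this]
  exact isClosed_iInter fun v => isClosed_eq (X := E)
    ((continuous_adjointMap_apply v).comp (h.continuous_orbit g)) continuous_const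

/-- A linear flow on a Lie group whose Lie algebra is of type `𝔤_{3,2}` has no periodic orbit. -/
theorem IsLinearVectorFieldWithFlow.not_isPeriodicOrbit [CompleteSpace E]
    (h : IsLinearVectorFieldWithFlow I X φ)
    (hG : IsOfTypeG32 (GroupLieAlgebra I G)) (g : G) : ¬ IsPeriodicOrbit φ g := by
  rintro ⟨hfix, T, hT, hper⟩
  have : LieGroup I (minSmoothness ℝ 3) G :=
    LieGroup.of_le (n := ∞) (by rw [minSmoothness_of_isRCLikeNormedField]; exact ENat.LEInfty.out)
  obtain ⟨B, hB⟩ := hG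
  have hTg : φ T g = g := by simpa [h.flow.initial] using hper 0
  have hTmem : T ∈ h.commuteTimes g := (h.commute_iff T g).mpr (by rw [hTg])
  -- The quarter time enters because the differential at time `t / 2` must itself be a square to
  -- have positive diagonal.
  have hhalf (t : ℝ) (ht : t ∈ h.commuteTimes g) : t / 2 ∈ h.commuteTimes g := by
    have ha := h.automorphism (t / 2 / 2)
    have hM := isLieGroupAutomorphism_conj (I := I) g
    refine hB.commute_of_commute_mul_self (A := differentialOne I (φ (t / 2 / 2))) ?_
      ha.differentialOne_injective ha.differentialOne_lie hM.differentialOne_injective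
      hM.differentialOne_lie ?_
    · rw [← h.differentialOne_add, add_halves]
    · rw [← h.differentialOne_add, add_halves]
      exact ht
  have hpow (n : ℕ) : T / 2 ^ n ∈ h.commuteTimes g := by
    induction n with
    | zero => simpa using hTmem
    | succ n ih =>
      rw [pow_succ, ← div_div]
      exact hhalf _ ih
  have hdense : Dense (h.commuteTimes g : Set ℝ) := by
    refine AddSubgroup.dense_of_not_isolated_zero _ fun ε hε => ?_
    obtain ⟨n, hn⟩ := pow_unbounded_of_one_lt (T / ε) (one_lt_two (α := ℝ))
    refine ⟨T / 2 ^ n, hpow n, by positivity, ?_⟩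
    rw [div_lt_iff₀ (by positivity)]
    rw [div_lt_iff₀ hε] at hn
    linarith
  have hall (t : ℝ) : adjointMap I (φ t g) = adjointMap I g := by
    refine (h.commute_iff t g).mp ?_
    have : t ∈ closure (h.commuteTimes g : Set ℝ) := hdense t
    rwa [(h.isClosed_commuteTimes g).closure_eq] at this
  -- `Ad` is now constant along the whole orbit, so the trivial centre kills its velocity.
  have hX : X (φ 0 g) = 0 :=
    velocity_eq_zero_of_adjointMap_eq (γ := fun t => φ t g)
      (fun w hw => hB.eq_zero_of_lie_eq_zero hw)
      (fun t => by rw [hall t, hall 0]) (h.flow.integralCurve g 0)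
  rw [h.flow.initial] at hX
  exact hfix (h.eq_of_eq_zero hX)

end Flow

theorem mainTheorem10 :
    -- the derivations of a Lie algebra of type `𝔤_{3,2}`, in an adapted basis
    (∀ (L : Type*) [LieRing L] [LieAlgebra ℝ L] (E : Module.Basis (Fin 3) ℝ L), IsG32Basis E →
      (∀ D : LieDerivation ℝ L L, ∃ α x₂ x₃ y₃ : ℝ,
        LinearMap.toMatrix E E (D : L →ₗ[ℝ] L) = !![α, x₂, x₃; 0, α, y₃; 0, 0, 0] ∧
        (LinearMap.toMatrix E E (D : L →ₗ[ℝ] L)).charpoly =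
          Polynomial.X * (Polynomial.X - Polynomial.C α) ^ 2) ∧
      (∀ α x₂ x₃ y₃ : ℝ, ∃ D : LieDerivation ℝ L L,
        LinearMap.toMatrix E E (D : L →ₗ[ℝ] L) = !![α, x₂, x₃; 0, α, y₃; 0, 0, 0])) ∧
    -- linear flows on a simply connected Lie group of type `𝔤_{3,2}` have no periodic orbits
    (∀ (G : Type*) [TopologicalSpace G] [T2Space G] [SecondCountableTopology G]
      [ChartedSpace (EuclideanSpace ℝ (Fin 3)) G] [Group G] [LieGroup (𝓡 3) ∞ G]
      [SimplyConnectedSpace G],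
      IsOfTypeG32 (GroupLieAlgebra (𝓡 3) G) →
      ∀ (X : (g : G) → TangentSpace (𝓡 3) g) (φ : ℝ → G → G),
        IsLinearVectorFieldWithFlow (𝓡 3) X φ → ∀ g : G, ¬ IsPeriodicOrbit φ g) := by
  refine ⟨fun L _ _ E hE => ⟨fun D => ⟨_, _, _, _, hE.toMatrix_derivation D, ?_⟩,
    hE.exists_derivation⟩, ?_⟩
  · rw [hE.toMatrix_derivation D, charpoly_derivation_matrix]
  · intro G _ _ _ _ _ _ _ hG X φ h g
    exact h.not_isPeriodicOrbit hG g
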